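/- Let $R$ be a commutative ring with unity and let $S\subseteq R$ be a multiplicative subset ($1\in S$, and $st\in S$ for all $s,t\in S$) with $0\notin S$. A sequence of $R$-modules $M\xrightarrow{f}N\xrightarrow{g}L$ is called $S$-exact at $N$ if there is $s\in S$ with $s\operatorname{Ker}(g)\subseteq\operatorname{Im}(f)$ and $s\operatorname{Im}(f)\subseteq\operatorname{Ker}(g)$; a longer sequence is $S$-exact if it is $S$-exact at each inner term (the element $s$ may depend on the term). An $R$-module $F$ is $S$-flat if for every $S$-exact sequence $0\to A\to B\to C\to 0$ of $R$-modules the induced sequence $0\to A\otimes_RF\to B\otimes_RF\to C\otimes_RF\to 0$ is $S$-exact. The $S$-flat dimension $S\text{-}fd_R(M)\in\mathbb N\cup\{\infty\}$ of an $R$-module $M$ is the least $m\ge 0$ for which there is an $S$-exact sequence $0\to F_m\to\cdots\to F_1\to F_0\to M\to 0$ with all $F_i$ $S$-flat, and $\infty$ if there is no such $m$. The $S$-weak global dimension of $R$ is $$S\text{-w.gl.dim}(R)=\sup\{S\text{-}fd_R(M)\mid M \text{ is an } R\text{-module}\}\in\mathbb N\cup\{\infty\}.$$ Regard $S$ also as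 a multiplicative subset of the polynomial ring $R[x_1,\dots,x_n]$, consisting of constant polynomials. Then for every integer $n\ge 1$, $$S\text{-w.gl.dim}(R[x_1,\dots,x_n])=S\text{-w.gl.dim}(R)+n,$$ where $\infty+n=\infty$. -/

import Mathlib

open scoped TensorProduct

universe u

/-- The sequence `M --f--> N --g--> L` is `S`-exact at `N`: there is `s ∈ S` with
`s Ker(g) ⊆ Im(f)` and `s Im(f) ⊆ Ker(g)`. The composite `g ∘ f` need not vanish. -/
def SExact {R : Type*} [CommRing R] (S : Submonoid R) {M N L : Type*}
    [AddCommGroup M] [Module R M] [AddCommGroup N] [Module R N] [AddCommGroup L] [Module R L]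
    (f : M →ₗ[R] N) (g : N →ₗ[R] L) : Prop :=
  ∃ s ∈ S, (∀ x ∈ LinearMap.ker g, s • x ∈ LinearMap.range f) ∧
    (∀ y ∈ LinearMap.range f, s • y ∈ LinearMap.ker g)

/-- The sequence `0 → A --f--> B --g--> C → 0` is `S`-exact (at `A`, at `B` and at `C`). -/
def ShortSExact {R : Type*} [CommRing R] (S : Submonoid R) {A B C : Type*}
    [AddCommGroup A] [Module R A] [AddCommGroup B] [Module R B] [AddCommGroup C] [Module R C]
    (f : A →ₗ[R] B) (g : B →ₗ[R] C) : Prop :=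
  SExact S (0 : PUnit.{1} →ₗ[R] A) f ∧ SExact S f g ∧ SExact S g (0 : C →ₗ[R] PUnit.{1})

/-- `F` is `S`-flat: tensoring with `F` preserves `S`-exactness of short sequences. -/
def IsSFlat {R : Type u} [CommRing R] (S : Submonoid R)
    (F : Type u) [AddCommGroup F] [Module R F] : Prop :=
  ∀ (A B C : Type u) [AddCommGroup A] [Module R A] [AddCommGroup B] [Module R B]
    [AddCommGroup C] [Module R C] (f : A →ₗ[R] B) (g : B →ₗ[R] C),
    ShortSExact S f g → ShortSExact S (f.rTensor F) (g.rTensor F)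

/-- `M` has an `S`-flat `S`-resolution `0 → F n → ⋯ → F 1 → F 0 → M → 0` of length `n`: an
`S`-exact sequence with all `F i` `S`-flat, continued to the left by zero modules `F i`, `i > n`. -/
def HasSFlatSResolution {R : Type u} [CommRing R] (S : Submonoid R)
    (M : Type u) [AddCommGroup M] [Module R M] (n : ℕ) : Prop :=
  ∃ (F : ℕ → ModuleCat.{u} R) (d : ∀ i, F (i + 1) →ₗ[R] F i) (ε : F 0 →ₗ[R] M),
    (∀ i ≤ n, IsSFlat S (F i)) ∧
    (∀ i, n < i → Subsingleton (F i)) ∧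
    (∀ i, SExact S (d (i + 1)) (d i)) ∧
    SExact S (d 0) ε ∧
    SExact S ε (0 : M →ₗ[R] PUnit.{1})

/-- The `S`-flat dimension of `M`: the length of the shortest `S`-flat `S`-resolution of `M`, and
`⊤` if there is none of finite length. -/
noncomputable def sFlatDim {R : Type u} [CommRing R] (S : Submonoid R)
    (M : Type u) [AddCommGroup M] [Module R M] : ℕ∞ :=
  ⨅ (n : ℕ) (_ : HasSFlatSResolution S M n), (n : ℕ∞)

/-- The `S`-weak global dimension of `R`: the supremum of the `S`-flat dimensions of all
`R`-modules. -/
noncomputable def sWeakGlobalDim {R : Type u} [CommRing R] (S : Submonoid R) : ℕ∞ :=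
  ⨆ M : ModuleCat.{u} R, sFlatDim S M

/-! By induction on the number of variables, using `MvPolynomial.finSuccEquiv`, it suffices to treat
`A[X]`, where the dimension rises by exactly one.

`S`-flatness says that every kernel of `X ⊗ F → Y ⊗ F`, with `X → Y` injective, is killed by one
element of `S` (`isSFlat_iff`). Hence modules killed by an element of `S` are `S`-flat, and nothing
changes under maps with such kernel and cokernel. So the dimension defined by `S`-exact resolutions
agrees with the one computed from honest projective syzygies (`sFlatDim_le_iff`), and the usual
dimension shifting applies.

Upper bound: an `A[X]`-module `M` has the exact sequence `0 → A[X] ⊗ M → A[X] ⊗ M → M → 0` with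
first map `X ⊗ 1 - 1 ⊗ X`, and `A[X]` is flat over `A` (`SFlatDimLE.polynomial`).

Lower bound: let `X` act as zero on an `A`-module `M`. Dimension at most `n + 1` over `A[X]` forces
dimension at most `n` over `A` (`SFlatDimLE.of_polynomial`). The base case holds because `M` is a
direct summand of `L / XL`, for `L` the kernel of a free cover of `M`. Since `0 ∉ S`, the module
`A[X]/(X)` is not `S`-flat, so the dimension over `A[X]` is never zero. -/

section General

/-! ### Factorizations up to an element of `S`. -/

variable {R : Type*} [CommRing R] {S : Submonoid R}

theorem LinearMap.lTensor_rTensor_apply {A B X Y : Type*} [AddCommGroup A] [Module R A]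
    [AddCommGroup B] [Module R B] [AddCommGroup X] [Module R X] [AddCommGroup Y] [Module R Y]
    (f : X →ₗ[R] Y) (g : A →ₗ[R] B) (x : X ⊗[R] A) :
    g.lTensor Y (f.rTensor A x) = f.rTensor B (g.lTensor X x) := by
  rw [← LinearMap.comp_apply, ← LinearMap.comp_apply, LinearMap.lTensor_comp_rTensor,
    LinearMap.rTensor_comp_lTensor]

variable {A B C : Type*} [AddCommGroup A] [Module R A] [AddCommGroup B] [Module R B]
  [AddCommGroup C] [Module R C]

theorem sExact_zero_left {f : A →ₗ[R] B} :
    SExact S (0 : PUnit.{1} →ₗ[R] A) f ↔ ∃ s ∈ S, ∀ x, f x = 0 → s • x = 0 := by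
  constructor
  · rintro ⟨s, hs, h, -⟩
    refine ⟨s, hs, fun x hx => ?_⟩
    obtain ⟨y, hy⟩ := h x hx
    simpa using hy.symm
  · rintro ⟨s, hs, h⟩
    refine ⟨s, hs, fun x hx => ⟨0, by simp [h x hx]⟩, ?_⟩
    rintro _ ⟨y, rfl⟩
    simp

theorem sExact_zero_right {g : B →ₗ[R] C} :
    SExact S g (0 : C →ₗ[R] PUnit.{1}) ↔ ∃ s ∈ S, ∀ y, ∃ x, g x = s • y := by
  constructor
  · rintro ⟨s, hs, h, -⟩
    exact ⟨s, hs, fun y => h y (by simp)⟩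
  · rintro ⟨s, hs, h⟩
    exact ⟨s, hs, fun y _ => h y, fun y _ => by simp⟩

/-- If `g` is `S`-surjective with `s Ker(g) ⊆ Im(f)`, the projection `B → B / Im(f)` factors
through `g` up to an element of `S`. -/
theorem exists_factor_mkQ_range {f : A →ₗ[R] B} {g : B →ₗ[R] C} {s t : R}
    (hs : ∀ x, g x = 0 → s • x ∈ LinearMap.range f) (ht : ∀ y, ∃ x, g x = t • y) :
    ∃ k : C →ₗ[R] B ⧸ LinearMap.range f, ∀ b, k (g b) = (s * t) • (LinearMap.range f).mkQ b := by
  choose r hr using ht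
  -- The chosen preimages `r` need not be linear; multiplication by `s` makes their classes
  -- independent of the choice.
  have key : ∀ b b', g b = g b' →
      s • (LinearMap.range f).mkQ b = s • (LinearMap.range f).mkQ b' := by
    intro b b' h
    rw [← sub_eq_zero, ← smul_sub, ← map_sub, ← map_smul]
    exact (Submodule.Quotient.mk_eq_zero _).2 (hs (b - b') (by simp [h]))
  refine ⟨{ toFun := fun c => s • (LinearMap.range f).mkQ (r c), map_add' := ?_, map_smul' := ?_ },
    fun b => ?_⟩
  · intro x y
    rw [← smul_add, ← map_add]
    exact key _ _ (by simp [hr])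
  · intro a x
    rw [RingHom.id_apply, smul_comm, ← map_smul]
    exact key _ _ (by rw [hr, map_smul, hr, smul_comm])
  · change s • (LinearMap.range f).mkQ (r (g b)) = _
    rw [mul_smul, ← map_smul _ t]
    exact key _ _ (by simp [hr])

/-- A map with kernel killed by `s` admits a map back from its range, up to `s`. -/
theorem exists_factor_of_smul_ker {f : A →ₗ[R] B} {s : R} (hs : ∀ x, f x = 0 → s • x = 0) :
    ∃ h : LinearMap.range f →ₗ[R] A, ∀ a, h (f.rangeRestrict a) = s • a := by
  refine ⟨(LinearMap.ker f).liftQ (s • LinearMap.id) (fun x hx => by simpa using hs x hx) ∘ₗ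
    f.quotKerEquivRange.symm.toLinearMap, fun a => ?_⟩
  have : f.quotKerEquivRange.symm (f.rangeRestrict a) = (LinearMap.ker f).mkQ a := by
    rw [LinearEquiv.symm_apply_eq]
    rfl
  rw [LinearMap.comp_apply, LinearEquiv.coe_coe, this]
  simp

end General

/-! ### `S`-flat modules. -/

section Flat

variable {R : Type u} [CommRing R] {S : Submonoid R}

/-- Right exactness of the tensor product survives up to `S` for any `F`, by factoring through `B /
Im f`. At the left end, `f` agrees up to `S` with the honest inclusion of its range. -/
theorem isSFlat_iff {F : Type u} [AddCommGroup F] [Module R F] :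
    IsSFlat S F ↔ ∀ (A B : Type u) [AddCommGroup A] [Module R A] [AddCommGroup B] [Module R B]
      (f : A →ₗ[R] B), Function.Injective f → ∃ s ∈ S, ∀ x, f.rTensor F x = 0 → s • x = 0 := by
  constructor
  · intro h A B _ _ _ _ f hf
    refine sExact_zero_left.1 (h A B (B ⧸ LinearMap.range f) f (LinearMap.range f).mkQ ⟨?_, ?_, ?_⟩).1
    · exact sExact_zero_left.2 ⟨1, S.one_mem, fun x hx => by simp [hf (hx.trans (map_zero f).symm)]⟩
    · exact ⟨1, S.one_mem, fun x hx => by simpa using hx, fun x hx => by simpa using hx⟩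
    · exact sExact_zero_right.2 ⟨1, S.one_mem, fun y => by
        simpa using Submodule.mkQ_surjective _ y⟩
  · rintro h A B C _ _ _ _ _ _ f g ⟨h1, ⟨t, ht, h2, h2'⟩, h3⟩
    obtain ⟨s, hs, h1⟩ := sExact_zero_left.1 h1
    obtain ⟨r, hr, h3⟩ := sExact_zero_right.1 h3
    refine ⟨?_, ?_, ?_⟩
    · obtain ⟨k, hk⟩ := exists_factor_of_smul_ker h1
      obtain ⟨w, hw, H⟩ := h _ _ (LinearMap.range f).subtype Subtype.val_injective
      refine sExact_zero_left.2 ⟨s * w, S.mul_mem hs hw, fun x hx => ?_⟩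
      have e1 : k ∘ₗ f.rangeRestrict = s • LinearMap.id := LinearMap.ext hk
      have e2 := H (f.rangeRestrict.rTensor F x) (by
        rw [← LinearMap.comp_apply, ← LinearMap.rTensor_comp]
        exact hx)
      have e3 := congrArg (k.rTensor F) e2
      rw [map_smul, ← LinearMap.comp_apply, ← LinearMap.rTensor_comp, e1] at e3
      simpa [mul_smul, smul_comm s w] using e3
    · obtain ⟨k, hk⟩ := exists_factor_mkQ_range h2 h3
      refine ⟨t * r, S.mul_mem ht hr, fun x hx => ?_, ?_⟩
      · have e1 : k ∘ₗ g = (t * r) • (LinearMap.range f).mkQ := LinearMap.ext hk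
        refine (rTensor_exact F (f := f) (g := (LinearMap.range f).mkQ)
          (fun y => by simp) (Submodule.mkQ_surjective _) _).1 ?_
        rw [map_smul, ← LinearMap.smul_apply, ← LinearMap.rTensor_smul, ← e1,
          LinearMap.rTensor_comp, LinearMap.comp_apply, hx, map_zero]
      · rintro _ ⟨y, rfl⟩
        have e1 : t • (g ∘ₗ f) = 0 := LinearMap.ext fun a => by
          simpa using h2' (f a) ⟨a, rfl⟩
        rw [LinearMap.mem_ker, map_smul, ← LinearMap.comp_apply, ← LinearMap.rTensor_comp,
          mul_comm, mul_smul, ← LinearMap.smul_apply, ← LinearMap.rTensor_smul, e1]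
        simp
    · refine sExact_zero_right.2 ⟨r, hr, fun y => ?_⟩
      induction y with
      | zero => exact ⟨0, by simp⟩
      | add a b ha hb =>
        obtain ⟨a', ha⟩ := ha
        obtain ⟨b', hb⟩ := hb
        exact ⟨a' + b', by simp [ha, hb]⟩
      | tmul c m =>
        obtain ⟨b, hb⟩ := h3 c
        exact ⟨b ⊗ₜ m, by simp [hb, TensorProduct.smul_tmul']⟩

variable {A B C : Type u} [AddCommGroup A] [Module R A] [AddCommGroup B] [Module R B]
  [AddCommGroup C] [Module R C]

theorem IsSFlat.of_flat [Module.Flat R A] : IsSFlat S A :=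
  isSFlat_iff.2 fun X Y _ _ _ _ f hf => ⟨1, S.one_mem, fun x hx => by
    rw [Module.Flat.rTensor_preserves_injective_linearMap f hf (hx.trans (map_zero _).symm),
      smul_zero]⟩

theorem IsSFlat.of_smul_eq_zero {s : R} (hs : s ∈ S) (h : ∀ a : A, s • a = 0) : IsSFlat S A :=
  isSFlat_iff.2 fun X Y _ _ _ _ f hf => ⟨s, hs, fun x hx => by
    clear hx
    induction x with
    | zero => simp
    | add a b ha hb => simp [ha, hb]
    | tmul c m => rw [← TensorProduct.tmul_smul, h, TensorProduct.tmul_zero]⟩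

theorem IsSFlat.of_retract (hB : IsSFlat S B) (i : A →ₗ[R] B) (p : B →ₗ[R] A)
    (hpi : p ∘ₗ i = LinearMap.id) : IsSFlat S A :=
  isSFlat_iff.2 fun X Y _ _ _ _ f hf => by
    obtain ⟨s, hs, h⟩ := isSFlat_iff.1 hB X Y f hf
    refine ⟨s, hs, fun x hx => ?_⟩
    have e := h (i.lTensor X x) (by rw [← LinearMap.lTensor_rTensor_apply, hx, map_zero])
    have e' := congrArg (p.lTensor X) e
    rw [map_smul, ← LinearMap.comp_apply, ← LinearMap.lTensor_comp, hpi] at e'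
    simpa using e'

theorem IsSFlat.congr (hB : IsSFlat S B) (e : A ≃ₗ[R] B) : IsSFlat S A :=
  hB.of_retract e.toLinearMap e.symm.toLinearMap (by ext; simp)

variable {f : A →ₗ[R] B} {g : B →ₗ[R] C}

theorem exists_projective_surjective (Y : Type u) [AddCommGroup Y] [Module R Y] :
    ∃ (P : Type u) (_ : AddCommGroup P) (_ : Module R P) (q : P →ₗ[R] Y),
      Module.Projective R P ∧ Function.Surjective q :=
  ⟨Y →₀ R, inferInstance, inferInstance, Finsupp.linearCombination R id, inferInstance,
    Finsupp.linearCombination_id_surjective R Y⟩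

/-- The kernel of `Y ⊗ A → Y ⊗ B`, a quotient of `Tor₁(Y, C)`, is `S`-torsion for `S`-flat `C`. -/
theorem IsSFlat.exists_smul_ker_lTensor (hC : IsSFlat S C) (hf : Function.Injective f)
    (hfg : Function.Exact f g) (hg : Function.Surjective g)
    (Y : Type u) [AddCommGroup Y] [Module R Y] :
    ∃ s ∈ S, ∀ y, f.lTensor Y y = 0 → s • y = 0 := by
  -- Snake lemma: `Tor₁(Y, C)` is the kernel of `ker q ⊗ C → P ⊗ C`, which `S`-flatness of `C` kills
  -- by `s`.
  obtain ⟨P, _, _, q, _, hq⟩ := exists_projective_surjective (R := R) Y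
  let j := (LinearMap.ker q).subtype
  have hjq : Function.Exact j q := fun x => by simp [j]
  have hj : Function.Injective j := Subtype.val_injective
  obtain ⟨s, hs, H⟩ := isSFlat_iff.1 hC _ _ j hj
  refine ⟨s, hs, fun y hy => ?_⟩
  obtain ⟨p, rfl⟩ := LinearMap.rTensor_surjective A hq y
  rw [LinearMap.lTensor_rTensor_apply] at hy
  obtain ⟨k, hk⟩ := (rTensor_exact B hjq hq _).1 hy
  have e1 := H (g.lTensor _ k) (by
    rw [← LinearMap.lTensor_rTensor_apply, hk, ← LinearMap.comp_apply, ← LinearMap.lTensor_comp,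
      hfg.linearMap_comp_eq_zero]
    simp)
  rw [← map_smul] at e1
  obtain ⟨k', hk'⟩ := (lTensor_exact _ hfg hg _).1 e1
  have e2 : j.rTensor A k' = s • p := by
    apply Module.Flat.lTensor_preserves_injective_linearMap (M := P) f hf
    rw [LinearMap.lTensor_rTensor_apply, hk', map_smul, map_smul, hk]
  rw [← map_smul, ← e2]
  exact (rTensor_exact A hjq hq _).2 ⟨_, rfl⟩

theorem IsSFlat.extension (hA : IsSFlat S A) (hC : IsSFlat S C) (hf : Function.Injective f)
    (hfg : Function.Exact f g) (hg : Function.Surjective g) : IsSFlat S B :=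
  isSFlat_iff.2 fun X Y _ _ _ _ h hh => by
    obtain ⟨s, hs, h1⟩ := isSFlat_iff.1 hC X Y h hh
    obtain ⟨t, ht, h2⟩ := hC.exists_smul_ker_lTensor hf hfg hg Y
    obtain ⟨r, hr, h3⟩ := isSFlat_iff.1 hA X Y h hh
    refine ⟨r * (t * s), S.mul_mem hr (S.mul_mem ht hs), fun z hz => ?_⟩
    have e1 := h1 (g.lTensor X z) (by rw [← LinearMap.lTensor_rTensor_apply, hz, map_zero])
    rw [← map_smul] at e1
    obtain ⟨w, hw⟩ := (lTensor_exact X hfg hg _).1 e1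
    -- The image of `w` in `Y ⊗ A` dies in `Y ⊗ B`, but `Y ⊗ A → Y ⊗ B` is injective only up to `t`.
    have e2 := h2 (h.rTensor A w) (by
      rw [LinearMap.lTensor_rTensor_apply, hw, map_smul, hz, smul_zero])
    rw [← map_smul] at e2
    rw [mul_smul, mul_smul, ← hw, ← map_smul, ← map_smul, h3 _ e2, map_zero]

theorem IsSFlat.ker (hB : IsSFlat S B) (hC : IsSFlat S C) (hf : Function.Injective f)
    (hfg : Function.Exact f g) (hg : Function.Surjective g) : IsSFlat S A :=
  isSFlat_iff.2 fun X Y _ _ _ _ h hh => by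
    obtain ⟨s, hs, h1⟩ := isSFlat_iff.1 hB X Y h hh
    obtain ⟨t, ht, h2⟩ := hC.exists_smul_ker_lTensor hf hfg hg X
    refine ⟨t * s, S.mul_mem ht hs, fun z hz => ?_⟩
    have e1 := h1 (f.lTensor X z) (by rw [← LinearMap.lTensor_rTensor_apply, hz, map_zero])
    rw [← map_smul] at e1
    rw [mul_smul, h2 _ e1]

end Flat

/-! ### Dimension shifting for projective syzygies. -/

section Dimension

variable {R : Type u} [CommRing R]

/-- `M` has `S`-flat dimension at most `n`, measured by syzygies of projective presentations. -/
def SFlatDimLE (S : Submonoid R) : ℕ → ∀ (M : Type u) [AddCommGroup M] [Module R M], Prop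
  | 0, M, _, _ => IsSFlat S M
  | n + 1, M, _, _ => ∃ (P : Type u) (_ : AddCommGroup P) (_ : Module R P) (p : P →ₗ[R] M),
      Module.Projective R P ∧ Function.Surjective p ∧ SFlatDimLE S n (LinearMap.ker p)

variable {S : Submonoid R} {A B C : Type u} [AddCommGroup A] [Module R A]
  [AddCommGroup B] [Module R B] [AddCommGroup C] [Module R C] {n : ℕ}

theorem SFlatDimLE.congr (hB : SFlatDimLE S n B) (e : A ≃ₗ[R] B) : SFlatDimLE S n A := by
  cases n with
  | zero => exact IsSFlat.congr hB e
  | succ n =>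
    obtain ⟨P, _, _, p, hP, hp, h⟩ := hB
    refine ⟨P, inferInstance, inferInstance, e.symm.toLinearMap ∘ₗ p, hP, ?_, ?_⟩
    · exact e.symm.surjective.comp hp
    · rwa [LinearEquiv.ker_comp]

variable {f : A →ₗ[R] B} {g : B →ₗ[R] C}

noncomputable def LinearMap.equivKerOfExact (hf : Function.Injective f)
    (hfg : Function.Exact f g) : A ≃ₗ[R] LinearMap.ker g :=
  (LinearEquiv.ofInjective f hf).trans (LinearEquiv.ofEq _ _ hfg.linearMap_ker_eq.symm)

theorem SFlatDimLE.succ_of_exact [Module.Projective R B] (hA : SFlatDimLE S n A)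
    (hf : Function.Injective f) (hfg : Function.Exact f g) (hg : Function.Surjective g) :
    SFlatDimLE S (n + 1) C :=
  ⟨B, inferInstance, inferInstance, g, inferInstance, hg,
    hA.congr (LinearMap.equivKerOfExact hf hfg).symm⟩

theorem SFlatDimLE.of_projective [Module.Projective R A] : SFlatDimLE S n A := by
  induction n generalizing A with
  | zero => exact IsSFlat.of_flat
  | succ n ih =>
    refine ⟨A, inferInstance, inferInstance, LinearMap.id, inferInstance,
      Function.surjective_id, ?_⟩
    have : Subsingleton (LinearMap.ker (LinearMap.id : A →ₗ[R] A)) := by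
      rw [LinearMap.ker_id]
      infer_instance
    exact ih

/-- Horseshoe lemma: projective covers of the ends give one of the middle, and the syzygies again
form a short exact sequence. -/
theorem SFlatDimLE.extension (hA : SFlatDimLE S n A) (hC : SFlatDimLE S n C)
    (hf : Function.Injective f) (hfg : Function.Exact f g) (hg : Function.Surjective g) :
    SFlatDimLE S n B := by
  induction n generalizing A B C with
  | zero => exact IsSFlat.extension hA hC hf hfg hg
  | succ n ih =>
    obtain ⟨P, _, _, p, hP, hp, hA⟩ := hA
    obtain ⟨Q, _, _, q, hQ, hq, hC⟩ := hC
    obtain ⟨q', rfl⟩ := Module.projective_lifting_property g q hg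
    have hgf : ∀ a, g (f a) = 0 := hfg.apply_apply_eq_zero
    have hβ : Function.Surjective ((f ∘ₗ p).coprod q') := fun b => by
      obtain ⟨y, hy⟩ := hq (g b)
      obtain ⟨a, ha⟩ := (hfg (b - q' y)).1 (by rw [map_sub, ← hy]; simp)
      obtain ⟨x, rfl⟩ := hp a
      exact ⟨(x, y), by simp [ha]⟩
    refine ⟨P × Q, inferInstance, inferInstance, (f ∘ₗ p).coprod q', inferInstance, hβ, ?_⟩
    refine ih hA hC (f := (LinearMap.inl R P Q).restrict fun x hx => ?_)
      (g := (LinearMap.snd R P Q).restrict fun x hx => ?_) ?_ ?_ ?_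
    · simp [LinearMap.mem_ker.1 hx]
    · have := congrArg g (LinearMap.mem_ker.1 hx)
      simpa [hgf] using this
    · intro x y hxy
      exact Subtype.ext (LinearMap.inl_injective (congrArg Subtype.val hxy))
    · rintro ⟨⟨x, y⟩, hx⟩
      constructor
      · intro h
        obtain rfl : y = 0 := congrArg Subtype.val h
        refine ⟨⟨x, ?_⟩, rfl⟩
        apply hf
        rw [map_zero]
        simpa using hx
      · rintro ⟨z, hz⟩
        rw [← hz]
        rfl
    · rintro ⟨y, hy⟩
      obtain ⟨a, ha⟩ := (hfg (q' y)).1 hy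
      obtain ⟨x, rfl⟩ := hp a
      exact ⟨⟨(-x, y), by simp [ha]⟩, rfl⟩

/-- A projective cover `p` of `B` also covers `C`, and `ker (g ∘ p)` is an extension of `ker g ≅ A`
by `ker p`. -/
theorem SFlatDimLE.coker (hA : SFlatDimLE S n A) (hB : SFlatDimLE S (n + 1) B)
    (hf : Function.Injective f) (hfg : Function.Exact f g) (hg : Function.Surjective g) :
    SFlatDimLE S (n + 1) C := by
  obtain ⟨P, _, _, p, hP, hp, hB⟩ := hB
  refine ⟨P, inferInstance, inferInstance, g ∘ₗ p, hP, hg.comp hp, ?_⟩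
  refine hB.extension (hA.congr (LinearMap.equivKerOfExact hf hfg).symm)
    (f := Submodule.inclusion (LinearMap.ker_le_ker_comp p g))
    (g := p.restrict fun x hx => hx) (Submodule.inclusion_injective _) ?_ ?_
  · rintro ⟨x, hx⟩
    constructor
    · intro h
      exact ⟨⟨x, congrArg Subtype.val h⟩, rfl⟩
    · rintro ⟨z, hz⟩
      rw [← hz]
      exact Subtype.ext z.2
  · rintro ⟨b, hb⟩
    obtain ⟨x, rfl⟩ := hp b
    exact ⟨⟨x, hb⟩, rfl⟩

theorem SFlatDimLE.fst_of_prod [Module.Projective R B] (h : SFlatDimLE S n (A × B)) :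
    SFlatDimLE S n A := by
  cases n with
  | zero =>
    exact IsSFlat.of_retract h (LinearMap.inl R A B) (LinearMap.fst R A B) (by ext; simp)
  | succ n =>
    refine (SFlatDimLE.of_projective (A := B)).coker h (f := LinearMap.inr R A B)
      (g := LinearMap.fst R A B) LinearMap.inr_injective ?_ LinearMap.fst_surjective
    rintro ⟨a, b⟩
    simp [eq_comm]

/-- Lift the cover of `C` to `q : P → B`. Then `A × P → B` is onto with kernel isomorphic to the
syzygy of `C`, so `A × P` is an extension of modules of dimension at most `n`; the projective factor
cancels. -/
theorem SFlatDimLE.ker (hB : SFlatDimLE S n B) (hC : SFlatDimLE S (n + 1) C)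
    (hf : Function.Injective f) (hfg : Function.Exact f g) (hg : Function.Surjective g) :
    SFlatDimLE S n A := by
  obtain ⟨P, _, _, p, hP, hp, hC⟩ := hC
  obtain ⟨q, rfl⟩ := Module.projective_lifting_property g p hg
  have hgf : ∀ a, g (f a) = 0 := hfg.apply_apply_eq_zero
  let π : A × P →ₗ[R] B := f.coprod q
  let e : LinearMap.ker π →ₗ[R] LinearMap.ker (g ∘ₗ q) :=
    (LinearMap.snd R A P).restrict fun x hx => by
      have := congrArg g (LinearMap.mem_ker.1 hx)
      simpa [π, hgf] using this
  have he : Function.Bijective e := by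
    constructor
    · refine (injective_iff_map_eq_zero e).2 ?_
      rintro ⟨⟨a, x⟩, hx⟩ h
      obtain rfl : x = 0 := congrArg Subtype.val h
      have : a = 0 := hf (by simpa [π] using hx)
      subst this
      rfl
    · rintro ⟨x, hx⟩
      obtain ⟨a, ha⟩ := (hfg (q x)).1 hx
      exact ⟨⟨(-a, x), by simp [π, ha]⟩, rfl⟩
  refine SFlatDimLE.fst_of_prod (B := P) ?_
  refine (hC.congr (LinearEquiv.ofBijective e he)).extension hB (f := (LinearMap.ker π).subtype)
    (g := π) Subtype.val_injective (fun x => by simp) fun b => ?_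
  obtain ⟨x, hx⟩ := hp (g b)
  obtain ⟨a, ha⟩ := (hfg (b - q x)).1 (by rw [map_sub, ← hx]; simp)
  exact ⟨(a, x), by simp [π, ha]⟩

theorem SFlatDimLE.succ (h : SFlatDimLE S n A) : SFlatDimLE S (n + 1) A := by
  induction n generalizing A with
  | zero =>
    obtain ⟨P, _, _, p, hP, hp⟩ := exists_projective_surjective (R := R) A
    exact ⟨P, inferInstance, inferInstance, p, hP, hp,
      IsSFlat.ker (f := (LinearMap.ker p).subtype) (g := p) IsSFlat.of_flat h
        Subtype.val_injective (fun x => by simp) hp⟩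
  | succ n ih =>
    obtain ⟨P, _, _, p, hP, hp, h⟩ := h
    exact ⟨P, inferInstance, inferInstance, p, hP, hp, ih h⟩

theorem SFlatDimLE.mono {m : ℕ} (h : SFlatDimLE S m A) (hmn : m ≤ n) : SFlatDimLE S n A := by
  induction hmn with
  | refl => exact h
  | step _ ih => exact ih.succ

theorem IsSFlat.sFlatDimLE (h : IsSFlat S A) : SFlatDimLE S n A :=
  SFlatDimLE.mono (m := 0) h n.zero_le

/-- Kernel and cokernel of `f` are killed by elements of `S`, hence `S`-flat; pass from `B` to the
range of `f`, then to `A`. -/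
theorem SFlatDimLE.of_sIso (hB : SFlatDimLE S n B) {s t : R} (hs : s ∈ S) (ht : t ∈ S)
    (h1 : ∀ x, f x = 0 → s • x = 0) (h2 : ∀ y, ∃ x, f x = t • y) : SFlatDimLE S n A := by
  have hK : IsSFlat S (LinearMap.ker f) :=
    IsSFlat.of_smul_eq_zero hs fun x => Subtype.ext (h1 x x.2)
  have hQ : IsSFlat S (B ⧸ LinearMap.range f) := by
    refine IsSFlat.of_smul_eq_zero ht fun x => ?_
    obtain ⟨b, rfl⟩ := Submodule.mkQ_surjective _ x
    rw [← map_smul]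
    exact (Submodule.Quotient.mk_eq_zero _).2 (h2 b)
  have hI : SFlatDimLE S n (LinearMap.range f) :=
    hB.ker hQ.sFlatDimLE (f := (LinearMap.range f).subtype) (g := (LinearMap.range f).mkQ)
      Subtype.val_injective (fun x => by simp) (Submodule.mkQ_surjective _)
  exact hK.sFlatDimLE.extension hI (f := (LinearMap.ker f).subtype) (g := f.rangeRestrict)
    Subtype.val_injective (fun x => by simp [Subtype.ext_iff]) f.surjective_rangeRestrict

end Dimension

/-! ### Comparison with `S`-exact resolutions. -/

section Resolution

variable {R : Type u} [CommRing R] {S : Submonoid R}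

theorem SFlatDimLE.hasSFlatSResolution {n : ℕ} {M : Type u} [AddCommGroup M] [Module R M]
    (h : SFlatDimLE S n M) : HasSFlatSResolution S M n := by
  induction n generalizing M with
  | zero =>
    refine ⟨fun i => Nat.casesOn i (ModuleCat.of R M) fun _ => ModuleCat.of R PUnit.{u + 1},
      fun _ => 0, LinearMap.id, ?_, ?_, ?_, ?_, ?_⟩
    · intro i hi
      obtain rfl : i = 0 := Nat.le_zero.1 hi
      exact h
    · rintro (_ | i) hi
      · omega
      · exact inferInstanceAs (Subsingleton PUnit.{u + 1})
    · intro i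
      refine ⟨1, S.one_mem, fun x _ => ⟨0, ?_⟩, fun y _ => by simp⟩
      exact Subsingleton.elim (α := PUnit.{u + 1}) _ _
    · refine ⟨1, S.one_mem, fun x hx => ?_, ?_⟩
      · obtain rfl : x = 0 := hx
        exact ⟨0, by simp⟩
      · rintro _ ⟨y, rfl⟩
        simp
    · exact sExact_zero_right.2 ⟨1, S.one_mem, fun y => ⟨y, by simp⟩⟩
  | succ n ih =>
    obtain ⟨P, _, _, p, hP, hp, h⟩ := h
    obtain ⟨F, d, ε, h1, h2, h3, ⟨s, hs, h4, h4'⟩, h5⟩ := ih h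
    obtain ⟨t, ht, h5⟩ := sExact_zero_right.1 h5
    refine ⟨fun i => Nat.casesOn i (ModuleCat.of R P) F,
      fun i => Nat.casesOn i ((LinearMap.ker p).subtype ∘ₗ ε) d, p, ?_, ?_, ?_, ?_, ?_⟩
    · rintro (_ | i) hi
      · exact IsSFlat.of_flat (A := P)
      · exact h1 i (by omega)
    · rintro (_ | i) hi
      · omega
      · exact h2 i (by omega)
    · rintro (_ | i)
      · refine ⟨s, hs, fun x hx => h4 x (Subtype.ext hx), fun y hy => ?_⟩
        exact congrArg Subtype.val (h4' y hy)
      · exact h3 i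
    · refine ⟨t, ht, fun x hx => ?_, ?_⟩
      · obtain ⟨y, hy⟩ := h5 ⟨x, hx⟩
        exact ⟨y, congrArg Subtype.val hy⟩
      · rintro _ ⟨y, rfl⟩
        exact (LinearMap.ker p).smul_mem t (ε y).2
    · exact sExact_zero_right.2 ⟨1, S.one_mem, fun y => by simpa using hp y⟩

theorem HasSFlatSResolution.sFlatDimLE {n : ℕ} {M : Type u} [AddCommGroup M] [Module R M]
    (h : HasSFlatSResolution S M n) : SFlatDimLE S n M := by
  induction n using Nat.strong_induction_on generalizing M with | _ n ih
  obtain ⟨F, d, ε, h1, h2, h3, ⟨s, hs, h4, h4'⟩, h5⟩ := h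
  obtain ⟨t, ht, h5⟩ := sExact_zero_right.1 h5
  obtain ⟨k, hk⟩ := exists_factor_mkQ_range h4 h5
  have hM : SFlatDimLE S n (F 0 ⧸ LinearMap.range (d 0)) → SFlatDimLE S n M := fun h => by
    -- If `k x = 0` and `ε b = t x`, then `s t b ∈ Im (d 0)`. A further `s` moves it into `ker ε`,
    -- so `s (s t) t` kills `x`.
    refine h.of_sIso (f := k) (S.mul_mem (S.mul_mem hs (S.mul_mem hs ht)) ht)
      (S.mul_mem hs ht) (fun x hx => ?_) fun y => ?_
    · obtain ⟨b, hb⟩ := h5 x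
      have e1 := hk b
      rw [hb, map_smul, hx, smul_zero, ← map_smul] at e1
      have e2 := h4' _ ((Submodule.Quotient.mk_eq_zero _).1 e1.symm)
      rw [LinearMap.mem_ker, map_smul, map_smul, hb] at e2
      simpa only [mul_smul] using e2
    · obtain ⟨b, rfl⟩ := Submodule.mkQ_surjective _ y
      exact ⟨ε b, hk b⟩
  apply hM
  cases n with
  | zero =>
    have := h2 1 zero_lt_one
    have h0 : LinearMap.range (d 0) = ⊥ := by
      rw [LinearMap.range_eq_bot, Subsingleton.elim (d 0) 0]
    exact SFlatDimLE.congr (n := 0) (h1 0 le_rfl) (Submodule.quotEquivOfEqBot _ h0)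
  | succ n =>
    have hK : SFlatDimLE S n (LinearMap.range (d 0)) := by
      refine ih n n.lt_succ_self ⟨fun i => F (i + 1), fun i => d (i + 1), (d 0).rangeRestrict,
        fun i hi => h1 _ (by omega), fun i hi => h2 _ (by omega), fun i => h3 _, ?_, ?_⟩
      · obtain ⟨s, hs, h6, h6'⟩ := h3 0
        exact ⟨s, hs, fun x hx => h6 x (congrArg Subtype.val hx), fun y hy =>
          Subtype.ext (h6' y hy)⟩
      · exact sExact_zero_right.2 ⟨1, S.one_mem, fun y => by
          simpa using (d 0).surjective_rangeRestrict y⟩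
    exact hK.coker (h1 0 (Nat.zero_le _)).sFlatDimLE (f := (LinearMap.range (d 0)).subtype)
      (g := (LinearMap.range (d 0)).mkQ) Subtype.val_injective (fun x => by simp)
      (Submodule.mkQ_surjective _)

theorem sFlatDim_le_iff {n : ℕ} {M : Type u} [AddCommGroup M] [Module R M] :
    sFlatDim S M ≤ n ↔ SFlatDimLE S n M := by
  refine ⟨fun h => ?_, fun h => iInf₂_le n h.hasSFlatSResolution⟩
  obtain ⟨m, hm⟩ := iInf_lt_iff.1 (h.trans_lt (Nat.cast_lt.2 n.lt_succ_self))
  obtain ⟨hm, hmn⟩ := iInf_lt_iff.1 hm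
  exact hm.sFlatDimLE.mono (Nat.lt_succ_iff.1 (Nat.cast_lt.1 hmn))

theorem sWeakGlobalDim_le_iff {n : ℕ} :
    sWeakGlobalDim S ≤ n ↔
      ∀ (M : Type u) [AddCommGroup M] [Module R M], SFlatDimLE S n M :=
  ⟨fun h M _ _ => sFlatDim_le_iff.1 ((le_iSup (fun M : ModuleCat.{u} R => sFlatDim S M)
    (ModuleCat.of R M)).trans h), fun h => iSup_le fun M => sFlatDim_le_iff.2 (h M)⟩

end Resolution

/-! ### Base change and descent to a quotient ring. -/

section BaseChange

variable {A B : Type u} [CommRing A] [CommRing B] [Algebra A B] {S : Submonoid A}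
  {T : Submonoid B} {L : Type u} [AddCommGroup L] [Module A L]

theorem IsSFlat.baseChange (hST : ∀ s ∈ S, algebraMap A B s ∈ T) (h : IsSFlat S L) :
    IsSFlat T (B ⊗[A] L) :=
  isSFlat_iff.2 fun X Y _ _ _ _ f hf => by
    -- Naturally `X ⊗[B] (B ⊗[A] L) ≅ X ⊗[A] L`, so the test over `B` becomes one over `A`.
    let : Module A X := Module.compHom X (algebraMap A B)
    let : Module A Y := Module.compHom Y (algebraMap A B)
    have : IsScalarTower A B X := IsScalarTower.of_algebraMap_smul fun _ _ => rfl
    have : IsScalarTower A B Y := IsScalarTower.of_algebraMap_smul fun _ _ => rfl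
    let φ := TensorProduct.AlgebraTensorModule.cancelBaseChange A B B X L
    let χ := TensorProduct.AlgebraTensorModule.cancelBaseChange A B B Y L
    have nat : ∀ z, (f.restrictScalars A).rTensor L (φ z) = χ (f.rTensor (B ⊗[A] L) z) := by
      intro z
      induction z with
      | zero => simp
      | add a b ha hb => simp only [map_add, ha, hb]
      | tmul x w =>
        induction w with
        | zero => simp
        | add a b ha hb => simp only [TensorProduct.tmul_add, map_add, ha, hb]
        | tmul b l => simp [φ, χ]
    obtain ⟨s, hs, H⟩ := isSFlat_iff.1 h X Y (f.restrictScalars A) hf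
    refine ⟨_, hST s hs, fun z hz => φ.injective ?_⟩
    rw [map_smul, map_zero, algebraMap_smul]
    exact H _ (by rw [nat, hz, map_zero])

theorem SFlatDimLE.baseChange [Module.Flat A B] (hST : ∀ s ∈ S, algebraMap A B s ∈ T) {n : ℕ}
    (h : SFlatDimLE S n L) : SFlatDimLE T n (B ⊗[A] L) := by
  induction n generalizing L with
  | zero => exact IsSFlat.baseChange hST h
  | succ n ih =>
    obtain ⟨P, _, _, p, hP, hp, h⟩ := h
    refine (ih h).succ_of_exact (f := (LinearMap.ker p).subtype.baseChange B)
      (g := p.baseChange B) ?_ ?_ ?_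
    · exact Module.Flat.lTensor_preserves_injective_linearMap _ Subtype.val_injective
    · exact lTensor_exact B (fun x => by simp) hp
    · exact LinearMap.lTensor_surjective B hp

/-- The multiplication map `B ⊗ L → L` of a `B`-module `L`. -/
noncomputable def LinearMap.scalarExtensionCounit (A B L : Type u) [CommRing A] [CommRing B]
    [Algebra A B] [AddCommGroup L] [Module A L] [Module B L] [IsScalarTower A B L] :
    B ⊗[A] L →ₗ[B] L :=
  LinearMap.liftBaseChange B LinearMap.id

theorem SFlatDimLE.of_bijective_algebraMap [Module B L] [IsScalarTower A B L]
    (hAB : Function.Bijective (algebraMap A B)) (hST : ∀ s ∈ S, algebraMap A B s ∈ T) {n : ℕ}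
    (h : SFlatDimLE S n L) : SFlatDimLE T n L := by
  let e : A ≃ₗ[A] B := LinearEquiv.ofBijective (Algebra.linearMap A B) hAB
  have : Module.Flat A B := Module.Flat.of_linearEquiv e.symm
  refine (h.baseChange hST).congr
    (LinearEquiv.ofBijective (LinearMap.scalarExtensionCounit A B L) ⟨?_, ?_⟩).symm
  · have : ∀ z : B ⊗[A] L, 1 ⊗ₜ[A] LinearMap.scalarExtensionCounit A B L z = z := by
      intro z
      induction z with
      | zero => simp
      | add a b ha hb => rw [map_add, TensorProduct.tmul_add, ha, hb]
      | tmul b l =>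
        obtain ⟨a, rfl⟩ := hAB.2 b
        simp [LinearMap.scalarExtensionCounit, TensorProduct.tmul_smul,
          TensorProduct.smul_tmul', Algebra.algebraMap_eq_smul_one]
    exact Function.LeftInverse.injective this
  · exact fun l => ⟨1 ⊗ₜ l, by simp [LinearMap.scalarExtensionCounit]⟩

/-- If `M` is a direct summand of `L / x L` then `M` is `S`-flat over `A` when `L` is so over `B`;
the splitting `σ` and the section `ν` modulo `x L` are given on `L` itself. -/
theorem IsSFlat.of_retract_quotient {A B : Type u} [CommRing A] [CommRing B] {S : Submonoid A}
    {T : Submonoid B} {L M : Type u} [AddCommGroup L] [Module B L] [AddCommGroup M] [Module A M]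
    [Module B M] (π : B →+* A) (hπ : Function.Surjective π) (hM : ∀ b (m : M), π b • m = b • m)
    (hST : ∀ s ∈ T, π s ∈ S) (hL : IsSFlat T L) (σ : L →ₗ[B] M) (ν : M → L)
    (hσν : ∀ m, σ (ν m) = m) {x : B} (hx : π x = 0)
    (hadd : ∀ m m', ∃ l, ν (m + m') = ν m + ν m' + x • l)
    (hsmul : ∀ (b : B) m, ∃ l, ν (b • m) = b • ν m + x • l) : IsSFlat S M := by
  let : Algebra B A := π.toAlgebra
  have : IsScalarTower B A M := IsScalarTower.of_algebraMap_smul hM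
  have h0 : ∀ l : L, (1 : A) ⊗ₜ[B] (x • l) = 0 := fun l => by
    rw [← TensorProduct.smul_tmul, Algebra.smul_def, show algebraMap B A x = 0 from hx, zero_mul,
      TensorProduct.zero_tmul]
  -- `ν` is linear only modulo `x L`, which vanishes in `A ⊗[B] L` because `π x = 0`.
  let ι : M →ₗ[A] A ⊗[B] L :=
    { toFun := fun m => 1 ⊗ₜ ν m
      map_add' := fun m m' => by
        obtain ⟨l, hl⟩ := hadd m m'
        rw [hl, TensorProduct.tmul_add, TensorProduct.tmul_add, h0, add_zero]
      map_smul' := fun a m => by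
        obtain ⟨b, rfl⟩ := hπ a
        obtain ⟨l, hl⟩ := hsmul b m
        rw [hM, hl, TensorProduct.tmul_add, h0, add_zero, RingHom.id_apply,
          TensorProduct.tmul_smul]
        exact (algebraMap_smul A b _).symm }
  exact (hL.baseChange (A := B) (B := A) hST).of_retract ι (σ.liftBaseChange A)
    (LinearMap.ext fun m => by simp [ι, hσν])

end BaseChange

/-! ### Invariance under ring isomorphism. -/

theorem sWeakGlobalDim_le_of_ringEquiv {A B : Type u} [CommRing A] [CommRing B] (e : A ≃+* B)
    (S : Submonoid A) : sWeakGlobalDim (S.map (e : A →+* B)) ≤ sWeakGlobalDim S := by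
  cases hn : sWeakGlobalDim S using ENat.recTopCoe with
  | top => exact le_top
  | coe n =>
  refine sWeakGlobalDim_le_iff.2 fun M _ _ => ?_
  let : Algebra A B := (e : A →+* B).toAlgebra
  let : Module A M := Module.compHom M (e : A →+* B)
  have : IsScalarTower A B M := IsScalarTower.of_algebraMap_smul fun _ _ => rfl
  exact (sWeakGlobalDim_le_iff.1 hn.le M).of_bijective_algebraMap e.bijective
    fun s hs => Submonoid.mem_map_of_mem _ hs

theorem sWeakGlobalDim_map_ringEquiv {A B : Type u} [CommRing A] [CommRing B] (e : A ≃+* B)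
    (S : Submonoid A) : sWeakGlobalDim (S.map (e : A →+* B)) = sWeakGlobalDim S := by
  refine (sWeakGlobalDim_le_of_ringEquiv e S).antisymm ?_
  have h : (S.map (e : A →+* B)).map (e.symm : B →+* A) = S := by
    ext x
    simp
  exact (congrArg sWeakGlobalDim h).symm.trans_le
    (sWeakGlobalDim_le_of_ringEquiv e.symm (S.map (e : A →+* B)))

/-! ### One polynomial variable. -/

section Polynomial

open Polynomial

variable {A : Type u} [CommRing A] {M : Type u} [AddCommGroup M] [Module A M]

noncomputable def TensorProduct.polynomialCoeff (i : ℕ) : A[X] ⊗[A] M →ₗ[A] M :=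
  TensorProduct.lid A M ∘ₗ (lcoeff A i).rTensor M

@[simp]
theorem TensorProduct.polynomialCoeff_tmul (i : ℕ) (p : A[X]) (m : M) :
    polynomialCoeff i (p ⊗ₜ[A] m) = p.coeff i • m := by
  simp [polynomialCoeff]

/-- Elements are polynomials with coefficients in `M`. Allowing every `n ≥ N` lets two elements be
expanded to a common length. -/
theorem TensorProduct.exists_eq_sum_polynomialCoeff (z : A[X] ⊗[A] M) :
    ∃ N, ∀ n ≥ N, polynomialCoeff n z = 0 ∧
      z = ∑ i ∈ Finset.range n, (X ^ i : A[X]) ⊗ₜ[A] polynomialCoeff i z := by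
  induction z with
  | zero => exact ⟨0, by simp⟩
  | add a b ha hb =>
    obtain ⟨N, hN⟩ := ha
    obtain ⟨K, hK⟩ := hb
    refine ⟨max N K, fun n hn => ⟨?_, ?_⟩⟩
    · rw [map_add, (hN n (le_of_max_le_left hn)).1, (hK n (le_of_max_le_right hn)).1, add_zero]
    · simp only [map_add, TensorProduct.tmul_add, Finset.sum_add_distrib]
      rw [← (hN n (le_of_max_le_left hn)).2, ← (hK n (le_of_max_le_right hn)).2]
  | tmul p m =>
    refine ⟨p.natDegree + 1, fun n hn => ⟨?_, ?_⟩⟩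
    · rw [polynomialCoeff_tmul, coeff_eq_zero_of_natDegree_lt hn, zero_smul]
    · conv_lhs => rw [p.as_sum_range' n hn, TensorProduct.sum_tmul]
      refine Finset.sum_congr rfl fun i _ => ?_
      rw [polynomialCoeff_tmul, TensorProduct.tmul_smul, TensorProduct.smul_tmul',
        ← monomial_one_right_eq_X_pow, smul_monomial, smul_eq_mul, mul_one]

variable [Module A[X] M] [IsScalarTower A A[X] M]

/-- `X ⊗ 1 - 1 ⊗ X` acting on `A[X] ⊗ M`. -/
noncomputable def LinearMap.polynomialDiff (A M : Type u) [CommRing A] [AddCommGroup M]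
    [Module A M] [Module A[X] M] [IsScalarTower A A[X] M] : A[X] ⊗[A] M →ₗ[A[X]] A[X] ⊗[A] M :=
  LinearMap.lsmul A[X] _ X - ((LinearMap.lsmul A[X] M X).restrictScalars A).baseChange A[X]

theorem LinearMap.polynomialDiff_tmul (p : A[X]) (m : M) :
    polynomialDiff A M (p ⊗ₜ m) = (X * p) ⊗ₜ[A] m - p ⊗ₜ[A] ((X : A[X]) • m) := by
  rfl

theorem LinearMap.polynomialCoeff_polynomialDiff (i : ℕ) (z : A[X] ⊗[A] M) :
    TensorProduct.polynomialCoeff (i + 1) (polynomialDiff A M z) =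
      TensorProduct.polynomialCoeff i z -
        (X : A[X]) • TensorProduct.polynomialCoeff (i + 1) z := by
  induction z with
  | zero => simp
  | add a b ha hb => rw [map_add, map_add, map_add, map_add, ha, hb, smul_add]; abel
  | tmul p m =>
    rw [polynomialDiff_tmul, map_sub]
    simp only [TensorProduct.polynomialCoeff_tmul, coeff_X_mul]
    rw [smul_comm]

/-- In the kernel each coefficient is `X` times the next; high coefficients vanish, so descending
induction kills all. -/
theorem LinearMap.polynomialDiff_injective : Function.Injective (polynomialDiff A M) := by
  refine (injective_iff_map_eq_zero _).2 fun z hz => ?_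
  obtain ⟨N, hN⟩ := TensorProduct.exists_eq_sum_polynomialCoeff z
  have h : ∀ i, TensorProduct.polynomialCoeff i z =
      (X : A[X]) • TensorProduct.polynomialCoeff (i + 1) z := fun i => by
    rw [← sub_eq_zero, ← polynomialCoeff_polynomialDiff, hz, map_zero]
  have h0 : ∀ k i, N ≤ i + k → TensorProduct.polynomialCoeff i z = 0 := by
    intro k
    induction k with
    | zero => exact fun i hi => (hN i hi).1
    | succ k ih => exact fun i hi => by rw [h, ih (i + 1) (by omega), smul_zero]
  rw [(hN N le_rfl).2]
  exact Finset.sum_eq_zero fun i _ => by rw [h0 N i (by omega), TensorProduct.tmul_zero]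

theorem LinearMap.exact_polynomialDiff :
    Function.Exact (polynomialDiff A M) (scalarExtensionCounit A A[X] M) := by
  -- Modulo the range, `X p ⊗ m` equals `p ⊗ X m`, so all powers of `X` can be moved to the right
  -- factor.
  have key : ∀ z, z - 1 ⊗ₜ scalarExtensionCounit A A[X] M z ∈ range (polynomialDiff A M) := by
    intro z
    induction z with
    | zero => simp
    | add a b ha hb =>
      rw [map_add, TensorProduct.tmul_add, add_sub_add_comm]
      exact add_mem ha hb
    | tmul p m =>
      simp only [scalarExtensionCounit, liftBaseChange_tmul, id_apply]
      induction p using Polynomial.induction_on generalizing m with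
      | C a =>
        rw [← mul_one (C a), ← smul_eq_C_mul, smul_assoc, one_smul, TensorProduct.tmul_smul,
          TensorProduct.smul_tmul', sub_self]
        exact zero_mem _
      | add p q hp hq =>
        rw [TensorProduct.add_tmul, add_smul, TensorProduct.tmul_add, add_sub_add_comm]
        exact add_mem (hp m) (hq m)
      | monomial n a ih =>
        have e : C a * X ^ (n + 1) = X * (C a * X ^ n) := by ring
        have := add_mem (mem_range_self (polynomialDiff A M) ((C a * X ^ n) ⊗ₜ m))
          (ih ((X : A[X]) • m))
        rw [polynomialDiff_tmul, sub_add_sub_cancel, ← mul_smul, mul_comm _ X] at this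
        rwa [e]
  intro z
  refine ⟨fun hz => by simpa [hz] using key z, ?_⟩
  rintro ⟨w, rfl⟩
  induction w with
  | zero => simp
  | add a b ha hb => rw [map_add, map_add, ha, hb, add_zero]
  | tmul p m =>
    simp [polynomialDiff_tmul, scalarExtensionCounit, ← mul_smul, mul_comm]

variable {S : Submonoid A} {n : ℕ}

theorem SFlatDimLE.polynomial (h : SFlatDimLE S n M) :
    SFlatDimLE (S.map (C : A →+* A[X])) (n + 1) M := by
  have hB : SFlatDimLE (S.map (C : A →+* A[X])) n (A[X] ⊗[A] M) :=
    h.baseChange fun s hs => Submonoid.mem_map_of_mem _ hs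
  exact hB.coker hB.succ LinearMap.polynomialDiff_injective LinearMap.exact_polynomialDiff
    fun m => ⟨1 ⊗ₜ m, by simp [LinearMap.scalarExtensionCounit]⟩

theorem Polynomial.smul_eq_coeff_zero_smul (hX : ∀ m : M, (X : A[X]) • m = 0) (p : A[X]) (m : M) :
    p • m = p.coeff 0 • m := by
  conv_lhs => rw [← divX_mul_X_add p]
  rw [add_smul, mul_smul, hX, smul_zero, zero_add, ← mul_one (C _), ← smul_eq_C_mul, smul_assoc,
    one_smul]

/-- Let `L` be the kernel of the free cover on the set `M`; it is `S`-flat over `A[X]`. The map `m ↦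
X e_m` embeds `M` in `L / XL`, with a retraction induced by `σ`. -/
theorem SFlatDimLE.isSFlat_of_polynomial (hX : ∀ m : M, (X : A[X]) • m = 0)
    (h : SFlatDimLE (S.map (C : A →+* A[X])) 1 M) : IsSFlat S M := by
  let f : (M →₀ A[X]) →ₗ[A[X]] M := Finsupp.linearCombination A[X] id
  have hf : Function.Surjective f := Finsupp.linearCombination_id_surjective A[X] M
  have hf1 : ∀ m, f (Finsupp.single m 1) = m := fun m => by simp [f]
  have hL : IsSFlat (S.map (C : A →+* A[X])) (LinearMap.ker f) :=
    SFlatDimLE.ker (n := 0) (f := (LinearMap.ker f).subtype) (g := f) IsSFlat.of_flat h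
      Subtype.val_injective (fun x => by simp) hf
  -- `σ` reads off the coefficients of `X`. Thus `σ (X q) = f q`: it kills `XL` and sends `X e_m` to
  -- `m`.
  let σ : (M →₀ A[X]) →ₗ[A] M :=
    Finsupp.linearCombination A id ∘ₗ Finsupp.mapRange.linearMap (lcoeff A 1)
  have hσX : ∀ q, σ ((X : A[X]) • q) = f q := fun q => by
    induction q using Finsupp.induction_linear with
    | zero => simp
    | add a b ha hb => rw [smul_add, map_add, map_add, ha, hb]
    | single m p =>
      rw [Finsupp.smul_single, smul_eq_mul]
      simp [-Finsupp.single_mul, σ, f, smul_eq_coeff_zero_smul hX p]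
  let σ' : LinearMap.ker f →ₗ[A[X]] M :=
    { toFun := fun l => σ l
      map_add' := fun a b => by rw [Submodule.coe_add, map_add]
      map_smul' := fun p l => by
        have hl : f (p.divX • (l : M →₀ A[X])) = 0 := by rw [map_smul, l.2, smul_zero]
        have hC : ∀ (a : A) (q : M →₀ A[X]), C a • q = a • q := fun a q => by
          rw [← mul_one (C a), ← smul_eq_C_mul, smul_assoc, one_smul]
        rw [RingHom.id_apply, smul_eq_coeff_zero_smul hX, Submodule.coe_smul, ← map_smul]
        conv_lhs => rw [← divX_mul_X_add p, add_smul, mul_comm, mul_smul, map_add, hσX, hl,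
          zero_add, hC] }
  have hνf : ∀ m : M, (X : A[X]) • Finsupp.single m (1 : A[X]) ∈ LinearMap.ker f := fun m => by
    rw [LinearMap.mem_ker, map_smul, hX]
  refine IsSFlat.of_retract_quotient (B := A[X]) (x := X) constantCoeff
    (fun a => ⟨C a, by simp⟩) (fun p m => (smul_eq_coeff_zero_smul hX p m).symm) ?_ hL σ'
    (fun m => ⟨_, hνf m⟩) (fun m => (hσX _).trans (hf1 m)) (by simp) ?_ ?_
  · rintro _ ⟨s, hs, rfl⟩
    simpa using hs
  · refine fun m m' => ⟨⟨Finsupp.single (m + m') 1 - (Finsupp.single m 1 + Finsupp.single m' 1),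
      ?_⟩, Subtype.ext ?_⟩
    · rw [LinearMap.mem_ker, map_sub, map_add, hf1, hf1, hf1, sub_self]
    · change (X : A[X]) • Finsupp.single (m + m') (1 : A[X]) = (X : A[X]) • _ + (X : A[X]) • _ +
        (X : A[X]) • (_ - _)
      rw [← smul_add, ← smul_add, add_sub_cancel]
  · refine fun b m => ⟨⟨Finsupp.single (b • m) 1 - b • Finsupp.single m 1, ?_⟩, Subtype.ext ?_⟩
    · rw [LinearMap.mem_ker, map_sub, map_smul, hf1, hf1, sub_self]
    · change (X : A[X]) • Finsupp.single (b • m) (1 : A[X]) = b • (X : A[X]) • _ +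
        (X : A[X]) • (_ - _)
      rw [smul_comm b, ← smul_add, add_sub_cancel]

theorem SFlatDimLE.of_polynomial (hX : ∀ m : M, (X : A[X]) • m = 0)
    (h : SFlatDimLE (S.map (C : A →+* A[X])) (n + 1) M) : SFlatDimLE S n M := by
  induction n generalizing M with
  | zero => exact h.isSFlat_of_polynomial hX
  | succ n ih =>
    obtain ⟨P, _, _, p, hP, hp⟩ := exists_projective_surjective (R := A) M
    let : Module A[X] P := Module.compHom P (constantCoeff : A[X] →+* A)
    have hsmul : ∀ (q : A[X]) (x : P), q • x = q.coeff 0 • x := fun _ _ => rfl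
    have : IsScalarTower A A[X] P := IsScalarTower.of_algebraMap_smul fun a x => by
      rw [hsmul, Polynomial.algebraMap_apply, Algebra.algebraMap_self, RingHom.id_apply, coeff_C_zero]
    have hXP : ∀ x : P, (X : A[X]) • x = 0 := fun x => by rw [hsmul, coeff_X_zero, zero_smul]
    let g : P →ₗ[A[X]] M :=
      { toFun := p
        map_add' := map_add p
        map_smul' := fun q x => by
          rw [hsmul, map_smul, RingHom.id_apply, smul_eq_coeff_zero_smul hX] }
    -- `P` is no longer projective over `A[X]`, but the upper bound still controls it, so the syzygy
    -- drops one degree over `A[X]` too.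
    have hP1 : SFlatDimLE (S.map (C : A →+* A[X])) (n + 1) P :=
      (SFlatDimLE.of_projective (S := S) (n := n) (A := P)).polynomial
    have hK : SFlatDimLE (S.map (C : A →+* A[X])) (n + 1) (LinearMap.ker g) :=
      hP1.ker h (f := (LinearMap.ker g).subtype) (g := g) Subtype.val_injective
        (fun x => by simp) hp
    exact (ih (M := LinearMap.ker g) (fun x => Subtype.ext (hXP x)) hK).succ_of_exact
      (f := (LinearMap.ker g).subtype.restrictScalars A) (g := p) Subtype.val_injective
      (fun x => ⟨fun hx => ⟨⟨x, hx⟩, rfl⟩, by rintro ⟨y, rfl⟩; exact y.2⟩) hp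

theorem not_isSFlat_quotient_X (hS : (0 : A) ∉ S) :
    ¬ IsSFlat (S.map (C : A →+* A[X])) (A[X] ⧸ Ideal.span {(X : A[X])}) := fun h => by
  -- Multiplication by `X` is injective on `A[X]` but zero on `A[X]/(X)`. So a constant `s ∈ S`
  -- would kill `A[X]/(X)`, giving `X ∣ C s` and `s = 0`.
  obtain ⟨_, ⟨s, hs, rfl⟩, H⟩ := isSFlat_iff.1 h A[X] A[X] (LinearMap.lsmul A[X] A[X] X)
    (fun p q hpq => isRegular_X.left hpq)
  have h1 : ∀ q : A[X], q • (1 : A[X] ⧸ Ideal.span {(X : A[X])}) = Ideal.Quotient.mk _ q :=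
    fun q => congrArg (Ideal.Quotient.mk _) (mul_one q)
  have hX : (X : A[X]) • (1 : A[X] ⧸ Ideal.span {(X : A[X])}) = 0 := by
    rw [h1]
    exact Ideal.Quotient.eq_zero_iff_mem.2 (Ideal.mem_span_singleton_self X)
  have e := H (1 ⊗ₜ 1) (by
    rw [LinearMap.rTensor_tmul, LinearMap.lsmul_apply, TensorProduct.smul_tmul, hX,
      TensorProduct.tmul_zero])
  have e' := congrArg (TensorProduct.lid A[X] _) e
  rw [map_smul, TensorProduct.lid_tmul, map_zero, one_smul, h1] at e'
  have e2 := Ideal.mem_span_singleton.1 (Ideal.Quotient.eq_zero_iff_mem.1 e')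
  rw [X_dvd_iff] at e2
  have hs0 : s = 0 := by simpa using e2
  exact hS (hs0 ▸ hs)

theorem sWeakGlobalDim_polynomial (hS : (0 : A) ∉ S) :
    sWeakGlobalDim (S.map (C : A →+* A[X])) = sWeakGlobalDim S + 1 := by
  apply le_antisymm
  · cases hn : sWeakGlobalDim S using ENat.recTopCoe with
    | top => exact le_top
    | coe n =>
      rw [← Nat.cast_succ]
      refine sWeakGlobalDim_le_iff.2 fun M _ _ => ?_
      let : Module A M := Module.compHom M (C : A →+* A[X])
      have : IsScalarTower A A[X] M := IsScalarTower.of_algebraMap_smul fun _ _ => rfl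
      exact (sWeakGlobalDim_le_iff.1 hn.le M).polynomial
  · cases hn : sWeakGlobalDim (S.map (C : A →+* A[X])) using ENat.recTopCoe with
    | top => exact le_top
    | coe n =>
      cases n with
      | zero =>
        exact (not_isSFlat_quotient_X hS (sWeakGlobalDim_le_iff.1 hn.le _)).elim
      | succ n =>
        rw [Nat.cast_succ]
        gcongr
        refine sWeakGlobalDim_le_iff.2 fun M _ _ => ?_
        let : Module A[X] M := Module.compHom M (constantCoeff : A[X] →+* A)
        have hsmul : ∀ (q : A[X]) (x : M), q • x = q.coeff 0 • x := fun _ _ => rfl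
        have : IsScalarTower A A[X] M := IsScalarTower.of_algebraMap_smul fun a x => by
          rw [hsmul, Polynomial.algebraMap_apply, Algebra.algebraMap_self, RingHom.id_apply, coeff_C_zero]
        exact (sWeakGlobalDim_le_iff.1 hn.le M).of_polynomial fun x => by
          rw [hsmul, coeff_X_zero, zero_smul]

end Polynomial

/-! ### Several variables. -/

theorem mainTheorem2 {R : Type u} [CommRing R] (S : Submonoid R) (hS : (0 : R) ∉ S)
    (n : ℕ) (hn : 1 ≤ n) :
    sWeakGlobalDim (S.map (MvPolynomial.C : R →+* MvPolynomial (Fin n) R)) =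
      sWeakGlobalDim S + (n : ℕ∞) := by
  clear hn
  induction n with
  | zero =>
    rw [Nat.cast_zero, add_zero]
    exact sWeakGlobalDim_map_ringEquiv (MvPolynomial.isEmptyRingEquiv R (Fin 0)).symm S
  | succ n ih =>
    have h0 : (0 : MvPolynomial (Fin n) R) ∉ S.map (MvPolynomial.C : R →+* _) := by
      rintro ⟨s, hs, h⟩
      exact hS ((MvPolynomial.C_eq_zero.1 h) ▸ hs)
    rw [← sWeakGlobalDim_map_ringEquiv (MvPolynomial.finSuccEquiv R n).toRingEquiv,
      Nat.cast_succ, ← add_assoc, ← ih, ← sWeakGlobalDim_polynomial h0]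
    congr 1
    ext x
    simp [MvPolynomial.finSuccEquiv_apply]
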